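/- For a finite simple graph $G$ let $\lambda(G)$ be the spectral radius of its adjacency matrix. Write $G\vee H$ for the join and $G\cup H$ for the disjoint union of graphs, $kK_1$ for the graph with $k$ vertices and no edges, and $K_{1,k}$ for the star with $k$ leaves. Let $H(4,3)$ be the $6$-vertex graph formed by a $4$-cycle and a triangle that share exactly one vertex. A graph is $H(4,3)$-free if it has no (not necessarily induced) subgraph isomorphic to $H(4,3)$. **Theorem.** Let $m\ge 58$ be an odd integer and let $G$ be an $H(4,3)$-free finite simple graph with exactly $m$ edges and no isolated vertices that is not isomorphic to the book graph $K_2\vee\frac{m-1}{2}K_1$. Let $\tilde\lambda(m)$ be the largest real root of $$x^4-mx^2-(m-3)x+m-3=0$$ (the equation has a real root). Then $\lambda(G)\le\tilde\lambda(m)$, with equality if and only if $G\cong K_1\vee\bigl(K_{1,\frac{m-3}{2}}\cup 2K_1\bigr)$. -/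

import Mathlib

/-- The join of two graphs: their disjoint union together with every edge between the two parts. -/
def graphJoin {V W : Type*} (G : SimpleGraph V) (H : SimpleGraph W) : SimpleGraph (V ⊕ W) :=
  SimpleGraph.sum G H ⊔ completeBipartiteGraph V W

/-- The edgeless graph on `k` vertices, that is, `k` disjoint copies of `K_1`. -/
def emptyG (k : ℕ) : SimpleGraph (Fin k) := ⊥

/-- The complete graph `K_k`. -/
def completeG (k : ℕ) : SimpleGraph (Fin k) := ⊤

/-- The star `K_{1,k}`. -/
def starG (k : ℕ) : SimpleGraph (Fin 1 ⊕ Fin k) := completeBipartiteGraph (Fin 1) (Fin k)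

/-- The fish graph `H(4,3)`: the 4-cycle `0 1 2 3` and the triangle `0 4 5`, sharing vertex `0`. -/
def fishGraph : SimpleGraph (Fin 6) :=
  SimpleGraph.fromEdgeSet
    {s(0, 1), s(1, 2), s(2, 3), s(3, 0), s(0, 4), s(4, 5), s(5, 0)}

/-- The book graph `K_2 ∨ k K_1`. -/
def bookGraph (k : ℕ) : SimpleGraph (Fin 2 ⊕ Fin k) := graphJoin (completeG 2) (emptyG k)

/-- The graph `K_1 ∨ (K_{1,k} ∪ 2 K_1)`. -/
def extremalGraph (k : ℕ) : SimpleGraph (Fin 1 ⊕ ((Fin 1 ⊕ Fin k) ⊕ Fin 2)) :=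
  graphJoin (completeG 1) (SimpleGraph.sum (starG k) (emptyG 2))

/-- The spectral radius of a finite graph: the largest absolute value of an eigenvalue of its
adjacency matrix. That matrix is real symmetric, so all its eigenvalues are real. -/
noncomputable def graphSpectralRadius {V : Type*} [Fintype V] [DecidableEq V]
    (G : SimpleGraph V) [DecidableRel G.Adj] : ℝ :=
  (spectralRadius ℝ (G.adjMatrix ℝ)).toReal

/-!
Scale a Perron vector `x` so that its largest entry, at a vertex `o`, equals 1, and let `ρ` be the
spectral radius. Expanding `ρ ^ 2 - ρ` over the walks of length two from `o`, and splitting the `m`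
edges according to their position relative to `o`, turns `m - 2 < ρ ^ 2 - ρ` into an upper bound on
a weighted sum of the deficiencies `1 - x y`. This bound makes the neighbourhood of `o` rich in
edges, so that `H(4,3)`-freeness forces these edges to form a star, and the total deficiency is then
less than one. As `m` is odd, every vertex must be adjacent to `o` and the number of neighbours
of `o` outside the star is 0 (the book graph) or 2. In the latter case the eigenvalue equations
exhibit `ρ` as a root of the quartic, which factors as `(x² - x - (m - 2)) (x² + x - 1) = 1`.
-/

open Finset SimpleGraph
open scoped Matrix

section Spectral

theorem isGreatest_norm_spectrum {𝕜 A : Type*} [NormedField 𝕜] [Ring A] [Algebra 𝕜 A] {a : A}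
    (hfin : (spectrum 𝕜 a).Finite) (hne : (spectrum 𝕜 a).Nonempty) :
    IsGreatest (norm '' spectrum 𝕜 a) (spectralRadius 𝕜 a).toReal := by
  obtain ⟨k, hk, hmax⟩ := Set.exists_max_image _ (fun k : 𝕜 => ‖k‖₊) hfin hne
  have hρ : spectralRadius 𝕜 a = ‖k‖₊ :=
    le_antisymm (iSup₂_le fun j hj => ENNReal.coe_le_coe.2 (hmax j hj))
      (le_iSup₂_of_le k hk le_rfl)
  rw [hρ]
  exact ⟨⟨k, hk, rfl⟩, Set.forall_mem_image.2 hmax⟩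

theorem abs_dotProduct_mulVec_le {ι : Type*} [Fintype ι] {A : Matrix ι ι ℝ}
    (hA : ∀ i j, 0 ≤ A i j) (y : ι → ℝ) : |y ⬝ᵥ A *ᵥ y| ≤ |y| ⬝ᵥ A *ᵥ |y| := by
  simp only [dotProduct, Matrix.mulVec, mul_sum]
  refine (abs_sum_le_sum_abs _ _).trans (sum_le_sum fun i _ => ?_)
  refine (abs_sum_le_sum_abs _ _).trans_eq (sum_congr rfl fun j _ => ?_)
  rw [abs_mul, abs_mul, abs_of_nonneg (hA i j), Pi.abs_apply, Pi.abs_apply]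

variable {V : Type*} [Fintype V] [DecidableEq V]

theorem isGreatest_graphSpectralRadius [Nonempty V] (G : SimpleGraph V) [DecidableRel G.Adj] :
    IsGreatest (norm '' spectrum ℝ (G.adjMatrix ℝ)) (graphSpectralRadius G) := by
  refine isGreatest_norm_spectrum Matrix.finite_real_spectrum ?_
  rw [(G.isHermitian_adjMatrix ℝ).spectrum_real_eq_range_eigenvalues]
  exact Set.range_nonempty _

theorem mem_spectrum_iff_exists_mulVec_eq_smul {K : Type*} [Field K] {A : Matrix V V K} {μ : K} :
    μ ∈ spectrum K A ↔ ∃ x : V → K, x ≠ 0 ∧ A *ᵥ x = μ • x := by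
  rw [← Matrix.spectrum_toLin', ← Module.End.hasEigenvalue_iff_mem_spectrum,
    Module.End.HasEigenvalue, Module.End.HasUnifEigenvalue, Submodule.ne_bot_iff]
  simp only [Module.End.mem_eigenspace_iff, Matrix.toLin'_apply, and_comm]

theorem posSemidef_algebraMap_sub {A : Matrix V V ℝ} (hA : A.IsHermitian) {ρ : ℝ}
    (hρ : ∀ μ ∈ spectrum ℝ A, μ ≤ ρ) : (algebraMap ℝ (Matrix V V ℝ) ρ - A).PosSemidef := by
  rw [Matrix.posSemidef_iff_isHermitian_and_spectrum_nonneg, ← spectrum.singleton_sub_eq]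
  refine ⟨.sub ?_ hA, ?_⟩
  · rw [Algebra.algebraMap_eq_smul_one]
    exact Matrix.isHermitian_one.smul (.all ρ)
  · rintro _ ⟨_, rfl, μ, hμ, rfl⟩
    exact sub_nonneg.2 (hρ μ hμ)

-- If `A y = μ y` with `|μ| = ρ`, then `|y|` maximizes the Rayleigh quotient of `A`, so it lies in
-- the kernel of the positive semidefinite matrix `ρ - A`.
theorem exists_nonneg_mulVec_eq_smul {A : Matrix V V ℝ} (hA : A.IsHermitian)
    (hA0 : ∀ i j, 0 ≤ A i j) {ρ : ℝ} (hρ : IsGreatest (norm '' spectrum ℝ A) ρ) :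
    ∃ x : V → ℝ, 0 ≤ x ∧ x ≠ 0 ∧ A *ᵥ x = ρ • x := by
  obtain ⟨⟨μ, hμ, hμρ⟩, hmax⟩ := hρ
  have hpsd := posSemidef_algebraMap_sub hA fun ν hν =>
    (le_abs_self ν).trans (hmax (Set.mem_image_of_mem norm hν))
  obtain ⟨y, hy0, hy⟩ := mem_spectrum_iff_exists_mulVec_eq_smul.1 hμ
  have hmulVec : (algebraMap ℝ (Matrix V V ℝ) ρ - A) *ᵥ |y| = ρ • |y| - A *ᵥ |y| := by
    rw [Matrix.sub_mulVec, Algebra.algebraMap_eq_smul_one, Matrix.smul_mulVec, Matrix.one_mulVec]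
  have hrayleigh : ρ * (|y| ⬝ᵥ |y|) ≤ |y| ⬝ᵥ A *ᵥ |y| := by
    have hyy : |y| ⬝ᵥ |y| = y ⬝ᵥ y := by simp [dotProduct]
    have hyy0 : 0 ≤ y ⬝ᵥ y := sum_nonneg fun v _ => mul_self_nonneg (y v)
    calc ρ * (|y| ⬝ᵥ |y|) = |y ⬝ᵥ A *ᵥ y| := by
          rw [hyy, hy, dotProduct_smul, smul_eq_mul, abs_mul, ← Real.norm_eq_abs μ, hμρ,
            abs_of_nonneg hyy0]
      _ ≤ |y| ⬝ᵥ A *ᵥ |y| := abs_dotProduct_mulVec_le hA0 y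
  refine ⟨|y|, abs_nonneg y, by simpa using hy0, ?_⟩
  have hker := (hpsd.dotProduct_mulVec_zero_iff |y|).1 <| by
    refine le_antisymm ?_ (hpsd.dotProduct_mulVec_nonneg _)
    rw [star_trivial, hmulVec, dotProduct_sub, dotProduct_smul, smul_eq_mul]
    exact sub_nonpos.2 hrayleigh
  rw [hmulVec, sub_eq_zero] at hker
  exact hker.symm

/-- A nonnegative eigenvector `x` of the adjacency matrix of `G` for the eigenvalue `μ`, scaled so
that its largest entry is `x o = 1`. -/
structure IsMaxEigenvector (G : SimpleGraph V) [DecidableRel G.Adj] (μ : ℝ) (x : V → ℝ) (o : V) :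
    Prop where
  nonneg : ∀ v, 0 ≤ x v
  le_one : ∀ v, x v ≤ 1
  apply_eq_one : x o = 1
  mul_apply : ∀ v, μ * x v = ∑ w ∈ G.neighborFinset v, x w

theorem exists_isMaxEigenvector [Nonempty V] (G : SimpleGraph V) [DecidableRel G.Adj] :
    ∃ x o, IsMaxEigenvector G (graphSpectralRadius G) x o := by
  obtain ⟨x, hx, hx0, hAx⟩ := exists_nonneg_mulVec_eq_smul (G.isHermitian_adjMatrix ℝ)
    (fun i j => by rw [adjMatrix_apply]; positivity) (isGreatest_graphSpectralRadius G)
  obtain ⟨o, ho⟩ := Finite.exists_max x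
  obtain ⟨v, hv⟩ := Function.ne_iff.1 hx0
  have hpos : 0 < x o := ((hx v).lt_of_ne' hv).trans_le (ho v)
  refine ⟨fun v => x v / x o, o, fun v => div_nonneg (hx v) hpos.le,
    fun v => (div_le_one hpos).2 (ho v), div_self hpos.ne', fun v => ?_⟩
  have hAxv := congrFun hAx v
  rw [adjMatrix_mulVec_apply, Pi.smul_apply, smul_eq_mul] at hAxv
  rw [← sum_div, hAxv, mul_div_assoc]

end Spectral

section Quartic

theorem quartic_eq_zero_iff {R : Type*} [CommRing R] {m x : R} :
    x ^ 4 - m * x ^ 2 - (m - 3) * x + m - 3 = 0 ↔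
      (x ^ 2 - x - (m - 2)) * (x ^ 2 + x - 1) = 1 := by
  rw [← sub_eq_zero (b := (1 : R))]
  ring_nf

theorem exists_isGreatest_quartic_root {m : ℝ} (hm : 1 ≤ m) :
    ∃ L, IsGreatest {x : ℝ | x ^ 4 - m * x ^ 2 - (m - 3) * x + m - 3 = 0} L ∧ 1 ≤ L := by
  set p : ℝ → ℝ := fun x => x ^ 4 - m * x ^ 2 - (m - 3) * x + m - 3
  have hp : Continuous p := by fun_prop
  have hfactor : ∀ x, p x = (x ^ 2 - x - (m - 2)) * (x ^ 2 + x - 1) - 1 := fun x => by ring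
  have hpos : ∀ x, m < x → 0 < p x := fun x hx => by
    rw [hfactor]
    nlinarith [mul_pos (sub_pos.2 (hm.trans_lt hx)) (sub_pos.2 (hm.trans_lt hx))]
  obtain ⟨y, hy, hy0⟩ : (0 : ℝ) ∈ p '' Set.Icc 1 (m + 1) :=
    intermediate_value_Icc (by linarith) hp.continuousOn
      ⟨by rw [hfactor]; linarith, (hpos _ (lt_add_one m)).le⟩
  have hbdd : BddAbove {x | p x = 0} := ⟨m, fun x hx => not_lt.1 fun h => (hpos x h).ne' hx⟩
  exact ⟨sSup {x | p x = 0}, ⟨(isClosed_eq hp continuous_const).csSup_mem ⟨y, hy0⟩ hbdd,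
    fun x hx => le_csSup hbdd hx⟩, hy.1.trans (le_csSup hbdd hy0)⟩

theorem sub_two_lt_sq_sub_self {m x : ℝ} (hx : 1 ≤ x)
    (hroot : (x ^ 2 - x - (m - 2)) * (x ^ 2 + x - 1) = 1) : m - 2 < x ^ 2 - x :=
  sub_pos.1 (pos_of_mul_pos_left (hroot ▸ one_pos) (by nlinarith))

end Quartic

namespace IsMaxEigenvector

variable {V : Type*} [Fintype V] {G : SimpleGraph V} [DecidableRel G.Adj] {μ : ℝ} {x : V → ℝ}
  {o : V}

theorem eigenvalue_eq_sum (hx : IsMaxEigenvector G μ x o) :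
    μ = ∑ w ∈ G.neighborFinset o, x w := by
  rw [← hx.mul_apply, hx.apply_eq_one, mul_one]

theorem mul_one_sub_nonneg (hx : IsMaxEigenvector G μ x o) (n : ℕ) (w : V) : 0 ≤ n * (1 - x w) :=
  mul_nonneg n.cast_nonneg (sub_nonneg.2 (hx.le_one w))

theorem one_le_mul_apply (hx : IsMaxEigenvector G μ x o) {w : V} (how : G.Adj o w) :
    1 ≤ μ * x w := by
  rw [hx.mul_apply, ← hx.apply_eq_one]
  exact single_le_sum (fun z _ => hx.nonneg z) (by simpa using how.symm)

theorem mul_apply_le_degree (hx : IsMaxEigenvector G μ x o) (w : V) :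
    μ * x w ≤ G.degree w := by
  rw [hx.mul_apply, ← card_neighborFinset_eq_degree, card_eq_sum_ones, Nat.cast_sum, Nat.cast_one]
  exact sum_le_sum fun z _ => hx.le_one z

end IsMaxEigenvector

section Fish

theorem exists_ne_notMem_of_card_add_two_le {α : Type*} {s t : Finset α} (h : #t + 2 ≤ #s) :
    ∃ a ∈ s, ∃ b ∈ s, a ≠ b ∧ a ∉ t ∧ b ∉ t := by
  classical
  obtain ⟨a, ha, b, hb, hab⟩ := one_lt_card.1 (show 1 < #(s \ t) by grind [le_card_sdiff t s])
  rw [mem_sdiff] at ha hb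
  exact ⟨a, ha.1, b, hb.1, hab, ha.2, hb.2⟩

theorem fishGraph_isContained {V : Type*} {G : SimpleGraph V} {o a b c p q : V}
    (hoa : G.Adj o a) (hab : G.Adj a b) (hbc : G.Adj b c) (hco : G.Adj c o)
    (hop : G.Adj o p) (hpq : G.Adj p q) (hqo : G.Adj q o) (hnodup : [o, a, b, c, p, q].Nodup) :
    fishGraph ⊑ G := by
  have hinj : Function.Injective ![o, a, b, c, p, q] := List.nodup_ofFn.1 (by simpa using hnodup)
  refine ⟨⟨⟨![o, a, b, c, p, q], fun {i j} hij => ?_⟩, hinj⟩⟩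
  fin_cases i <;> fin_cases j <;> simp_all [fishGraph, adj_comm]

/-- Every edge of `H` meets every path with two edges: `H` has no subgraph `K_{1,2} ∪ K_2`. This is
what fish-freeness says about the neighbourhood of a vertex. -/
def EdgesMeetPaths {W : Type*} (H : SimpleGraph W) : Prop :=
  ∀ ⦃a v b y z⦄, H.Adj v a → H.Adj v b → a ≠ b → H.Adj y z →
    (y = a ∨ y = v ∨ y = b) ∨ (z = a ∨ z = v ∨ z = b)

theorem edgesMeetPaths_induce {V : Type*} {G : SimpleGraph V} (hfree : fishGraph.Free G) {o : V}
    {s : Set V} (hs : s ⊆ G.neighborSet o) : EdgesMeetPaths (G.induce s) := by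
  rintro ⟨a, ha⟩ ⟨v, hv⟩ ⟨b, hb⟩ ⟨y, hy⟩ ⟨z, hz⟩ hva hvb hab hyz
  have hoa : G.Adj o a := hs ha
  have hov : G.Adj o v := hs hv
  have hob : G.Adj o b := hs hb
  have hoy : G.Adj o y := hs hy
  have hoz : G.Adj o z := hs hz
  simp only [comap_adj, Function.Embedding.subtype_apply, ne_eq, Subtype.mk.injEq] at *
  by_contra! h
  exact hfree (fishGraph_isContained hoa hva.symm hvb hob.symm hoy hyz hoz.symm
    (by grind [SimpleGraph.ne_of_adj]))

variable {W : Type*} [Fintype W] {H : SimpleGraph W} [DecidableRel H.Adj]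

theorem two_mul_card_edgeFinset_le {T : Finset W} {d : ℕ} (hT : H.support ⊆ T)
    (hd : ∀ v, H.degree v ≤ d) : 2 * #H.edgeFinset ≤ #T * d := by
  rw [← sum_degrees_eq_twice_card_edges, ← sum_subset (subset_univ T) fun v _ hv =>
    (H.degree_eq_zero_iff_notMem_support v).2 fun h => hv (hT h)]
  exact sum_le_card_nsmul _ _ _ fun v _ => hd v

namespace EdgesMeetPaths

variable {v : W}

theorem eq_or_eq_of_four_le_degree (hH : EdgesMeetPaths H) (hv : 4 ≤ H.degree v) {y z : W}
    (hyz : H.Adj y z) : y = v ∨ z = v := by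
  classical
  obtain ⟨a, ha, b, hb, hab, hat, hbt⟩ :=
    exists_ne_notMem_of_card_add_two_le (s := H.neighborFinset v) (t := {y, z})
      (by grind [card_le_two, card_neighborFinset_eq_degree])
  rw [mem_neighborFinset] at ha hb
  grind [hH ha hb hab hyz]

theorem support_subset_insert [DecidableEq W] (hH : EdgesMeetPaths H) (hv : 3 ≤ H.degree v) :
    H.support ⊆ (insert v (H.neighborFinset v) : Finset W) := by
  rintro y ⟨z, hyz⟩
  obtain ⟨a, ha, b, hb, hab, haz, hbz⟩ :=
    exists_ne_notMem_of_card_add_two_le (s := H.neighborFinset v) (t := {z})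
      (by rwa [card_singleton, card_neighborFinset_eq_degree])
  rw [mem_neighborFinset] at ha hb
  have := hH ha hb hab hyz
  simp only [coe_insert, Set.mem_insert_iff, mem_coe, mem_neighborFinset]
  grind [adj_comm]

theorem support_subset_union [DecidableEq W] (hH : EdgesMeetPaths H) {a b : W}
    (hab : a ≠ b) (hv : H.neighborFinset v = {a, b}) :
    H.support ⊆ (H.neighborFinset v ∪ (H.neighborFinset a ∪ H.neighborFinset b) : Finset W) := by
  rintro y ⟨z, hyz⟩
  have ha : H.Adj v a := by simp [← mem_neighborFinset, hv]
  have hb : H.Adj v b := by simp [← mem_neighborFinset, hv]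
  have := hH ha hb hab hyz
  simp only [coe_union, Set.mem_union, mem_coe, mem_neighborFinset]
  grind [adj_comm]

theorem exists_four_le_degree (hH : EdgesMeetPaths H) (hcard : 6 < #H.edgeFinset) {u : W}
    (hu : 2 ≤ H.degree u) :
    ∃ v, 4 ≤ H.degree v ∧ ∀ ⦃y z⦄, H.Adj y z → y = v ∨ z = v := by
  classical
  have : Nonempty W := ⟨u⟩
  obtain ⟨v, hv⟩ := H.exists_maximal_degree_vertex
  have hmax : ∀ w, H.degree w ≤ H.degree v := fun w => hv ▸ H.degree_le_maxDegree w
  obtain h2 | h3 | h4 : H.degree v = 2 ∨ H.degree v = 3 ∨ 4 ≤ H.degree v := by grind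
  · obtain ⟨a, b, hab, hN⟩ := card_eq_two.1 ((H.card_neighborFinset_eq_degree v).trans h2)
    have hle := two_mul_card_edgeFinset_le (hH.support_subset_union hab hN) hmax
    have hunion :
        #(H.neighborFinset v ∪ (H.neighborFinset a ∪ H.neighborFinset b)) ≤ 2 + (2 + 2) := by
      grw [card_union_le, card_union_le]
      grind [card_neighborFinset_eq_degree]
    grind
  · have hle := two_mul_card_edgeFinset_le (hH.support_subset_insert h3.ge) hmax
    rw [card_insert_of_notMem (by simp), card_neighborFinset_eq_degree, h3] at hle
    grind
  · exact ⟨v, h4, fun y z => hH.eq_or_eq_of_four_le_degree h4⟩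

end EdgesMeetPaths

end Fish

section Counting

variable {V : Type*} [Fintype V] [DecidableEq V] (G : SimpleGraph V) [DecidableRel G.Adj]

/-- The number of common neighbours of `o` and `w`. -/
def codegree (o w : V) : ℕ :=
  #(G.neighborFinset o ∩ G.neighborFinset w)

/-- The vertices at distance at least two from `o`. -/
def farFinset (o : V) : Finset V :=
  (insert o (G.neighborFinset o))ᶜ

/-- The number `e(S)` of edges of `G` with both ends in `S`. -/
def inducedEdgeCount (S : Finset V) : ℕ :=
  #(G.induce (S : Set V)).edgeFinset

variable {G}

theorem mem_farFinset {o w : V} : w ∈ farFinset G o ↔ w ≠ o ∧ ¬ G.Adj o w := by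
  simp [farFinset]

theorem codegree_pos_iff {o w : V} : 0 < codegree G o w ↔ ∃ z, G.Adj o z ∧ G.Adj w z := by
  simp [codegree, card_pos, Finset.Nonempty]

theorem degree_eq_codegree_add {o w : V} (hw : w ∈ farFinset G o) :
    G.degree w = codegree G o w + #(farFinset G o ∩ G.neighborFinset w) := by
  rw [codegree, ← card_union_of_disjoint, ← union_inter_distrib_right,
    ← card_neighborFinset_eq_degree]
  · congr 1
    grind [mem_farFinset, mem_neighborFinset, adj_comm]
  · rw [Finset.disjoint_left]
    grind [mem_farFinset, mem_neighborFinset]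

variable (G)

theorem degree_induce (S : Finset V) (u : S) :
    (G.induce (S : Set V)).degree u = #(S ∩ G.neighborFinset u) := by
  rw [← card_neighborFinset_eq_degree, ← card_map (Function.Embedding.subtype _)]
  congr 1
  ext w
  simp [and_comm]

theorem sum_card_inter_neighborFinset (S : Finset V) :
    ∑ u ∈ S, #(S ∩ G.neighborFinset u) = 2 * inducedEdgeCount G S := by
  rw [inducedEdgeCount, ← sum_degrees_eq_twice_card_edges, ← sum_coe_sort]
  exact (Fintype.sum_congr _ _ fun u => degree_induce G S u).symm

theorem sum_codegree_neighborFinset (o : V) :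
    ∑ u ∈ G.neighborFinset o, codegree G o u = 2 * inducedEdgeCount G (G.neighborFinset o) :=
  sum_card_inter_neighborFinset G _

theorem sum_sum_neighborFinset {R : Type*} [NonAssocSemiring R] (S : Finset V) (f : V → R) :
    ∑ u ∈ S, ∑ w ∈ G.neighborFinset u, f w = ∑ w, #(S ∩ G.neighborFinset w) * f w := by
  rw [sum_comm' (t' := univ) (s' := fun w => S ∩ G.neighborFinset w) (by simp [adj_comm, and_comm])]
  simp only [sum_const, nsmul_eq_mul]

theorem sum_univ_eq_add_sum_farFinset {M : Type*} [AddCommMonoid M] (o : V) (f : V → M) :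
    ∑ w, f w = f o + ∑ w ∈ G.neighborFinset o, f w + ∑ w ∈ farFinset G o, f w := by
  rw [← sum_insert (G.notMem_neighborFinset_self o), farFinset, sum_add_sum_compl]

theorem card_edgeFinset_eq (o : V) :
    #G.edgeFinset = G.degree o + inducedEdgeCount G (G.neighborFinset o) +
      ∑ w ∈ farFinset G o, codegree G o w + inducedEdgeCount G (farFinset G o) := by
  have hnear : ∑ u ∈ G.neighborFinset o, G.degree u = ∑ w, codegree G o w := by
    simpa [codegree] using sum_sum_neighborFinset G (G.neighborFinset o) (fun _ => (1 : ℕ))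
  have hfar : ∑ w ∈ farFinset G o, G.degree w =
      ∑ w ∈ farFinset G o, codegree G o w + 2 * inducedEdgeCount G (farFinset G o) := by
    rw [sum_congr rfl fun w hw => degree_eq_codegree_add hw, sum_add_distrib,
      sum_card_inter_neighborFinset]
  have hself : codegree G o o = G.degree o := by simp [codegree]
  have hhandshake := G.sum_degrees_eq_twice_card_edges
  rw [sum_univ_eq_add_sum_farFinset G o, hnear, hfar, sum_univ_eq_add_sum_farFinset G o, hself,
    sum_codegree_neighborFinset] at hhandshake
  lia

namespace IsMaxEigenvector

variable {G} {μ : ℝ} {x : V → ℝ} {o : V}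

theorem sq_eigenvalue_eq (hx : IsMaxEigenvector G μ x o) :
    μ ^ 2 = G.degree o + ∑ w ∈ G.neighborFinset o, codegree G o w * x w +
      ∑ w ∈ farFinset G o, codegree G o w * x w := by
  calc μ ^ 2 = ∑ u ∈ G.neighborFinset o, μ * x u := by
        rw [← mul_sum, ← hx.eigenvalue_eq_sum, sq]
    _ = ∑ w, codegree G o w * x w := by
        simp_rw [hx.mul_apply, sum_sum_neighborFinset, codegree]
    _ = _ := by
        rw [sum_univ_eq_add_sum_farFinset G o, hx.apply_eq_one, mul_one, codegree, inter_self,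
          card_neighborFinset_eq_degree]

theorem sq_eigenvalue_sub_card_edgeFinset (hx : IsMaxEigenvector G μ x o) :
    μ ^ 2 - #G.edgeFinset = ∑ w ∈ G.neighborFinset o, codegree G o w * x w -
      inducedEdgeCount G (G.neighborFinset o) -
      ∑ w ∈ farFinset G o, codegree G o w * (1 - x w) - inducedEdgeCount G (farFinset G o) := by
  rw [hx.sq_eigenvalue_eq, card_edgeFinset_eq G o]
  simp only [mul_sub, mul_one, sum_sub_distrib]
  push_cast
  ring

end IsMaxEigenvector

end Counting

section Star

variable {V : Type*} [Fintype V] [DecidableEq V] {G : SimpleGraph V} [DecidableRel G.Adj] {o v : V}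

/-- The edges of `G` between neighbours of `o` form a star with centre `v`. -/
structure IsStarCenter (G : SimpleGraph V) (o v : V) : Prop where
  adj : G.Adj o v
  eq_or_eq : ∀ ⦃y z⦄, G.Adj o y → G.Adj o z → G.Adj y z → y = v ∨ z = v

/-- The neighbours of `o` which are neither equal nor adjacent to `v`. -/
def privateNeighborFinset (G : SimpleGraph V) [DecidableRel G.Adj] (o v : V) : Finset V :=
  G.neighborFinset o \ insert v (G.neighborFinset v)

theorem mem_privateNeighborFinset {y : V} :
    y ∈ privateNeighborFinset G o v ↔ G.Adj o y ∧ y ≠ v ∧ ¬ G.Adj v y := by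
  simp [privateNeighborFinset]

theorem exists_isStarCenter (hfree : fishGraph.Free G)
    (hcard : 6 < inducedEdgeCount G (G.neighborFinset o)) {u : V} (hou : G.Adj o u)
    (hu : 2 ≤ codegree G o u) : ∃ v, IsStarCenter G o v ∧ 4 ≤ codegree G o v := by
  have hpaths : EdgesMeetPaths (G.induce (G.neighborFinset o : Set V)) :=
    edgesMeetPaths_induce hfree (G.coe_neighborFinset o).subset
  obtain ⟨⟨v, hov⟩, hv, hstar⟩ := hpaths.exists_four_le_degree hcard
    (u := ⟨u, by simpa using hou⟩) (by rwa [degree_induce])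
  rw [degree_induce] at hv
  refine ⟨v, ⟨by simpa using hov, fun y z hoy hoz hyz => ?_⟩, hv⟩
  simpa [Subtype.ext_iff] using @hstar ⟨y, by simpa using hoy⟩ ⟨z, by simpa using hoz⟩ hyz

theorem sum_neighborFinset_eq {M : Type*} [AddCommMonoid M] (hov : G.Adj o v) (f : V → M) :
    ∑ y ∈ G.neighborFinset o, f y =
      f v + ∑ y ∈ G.neighborFinset o ∩ G.neighborFinset v, f y +
        ∑ y ∈ privateNeighborFinset G o v, f y := by
  rw [← sum_inter_add_sum_sdiff _ (insert v (G.neighborFinset v)),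
    inter_insert_of_mem (by simpa using hov), sum_insert (by simp), privateNeighborFinset]

namespace IsStarCenter

theorem codegree_eq_one (h : IsStarCenter G o v) {y : V} (hoy : G.Adj o y) (hvy : G.Adj v y) :
    codegree G o y = 1 := by
  rw [codegree, card_eq_one]
  refine ⟨v, eq_singleton_iff_unique_mem.2 ⟨by simp [h.adj, hvy.symm], fun z hz => ?_⟩⟩
  simp only [mem_inter, mem_neighborFinset] at hz
  exact (h.eq_or_eq hoy hz.1 hz.2).resolve_left hvy.ne'

theorem codegree_eq_zero (h : IsStarCenter G o v) {y : V} (hy : y ∈ privateNeighborFinset G o v) :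
    codegree G o y = 0 := by
  obtain ⟨hoy, hyv, hvy⟩ := mem_privateNeighborFinset.1 hy
  by_contra h0
  obtain ⟨z, hoz, hyz⟩ := codegree_pos_iff.1 (Nat.pos_of_ne_zero h0)
  obtain rfl := (h.eq_or_eq hoy hoz hyz).resolve_left hyv
  exact hvy hyz.symm

theorem sum_codegree_mul {R : Type*} [NonAssocSemiring R] (h : IsStarCenter G o v) (f : V → R) :
    ∑ y ∈ G.neighborFinset o, codegree G o y * f y =
      codegree G o v * f v + ∑ y ∈ G.neighborFinset o ∩ G.neighborFinset v, f y := by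
  have hleaf : ∀ y ∈ G.neighborFinset o ∩ G.neighborFinset v, codegree G o y * f y = f y := by
    intro y hy
    simp only [mem_inter, mem_neighborFinset] at hy
    rw [h.codegree_eq_one hy.1 hy.2, Nat.cast_one, one_mul]
  have hprivate : ∀ y ∈ privateNeighborFinset G o v, codegree G o y * f y = 0 := fun y hy => by
    rw [h.codegree_eq_zero hy, Nat.cast_zero, zero_mul]
  rw [sum_neighborFinset_eq h.adj, sum_congr rfl hleaf, sum_eq_zero hprivate, add_zero]

theorem inducedEdgeCount_eq (h : IsStarCenter G o v) :
    inducedEdgeCount G (G.neighborFinset o) = codegree G o v := by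
  have hsum := h.sum_codegree_mul fun _ => 1
  simp only [Nat.cast_id, mul_one, sum_codegree_neighborFinset, ← card_eq_sum_ones] at hsum
  rw [← codegree] at hsum
  lia

theorem degree_eq (h : IsStarCenter G o v) :
    G.degree o = 1 + codegree G o v + #(privateNeighborFinset G o v) := by
  simpa [codegree] using sum_neighborFinset_eq h.adj fun _ => (1 : ℕ)

theorem codegree_le_two_of_mem_farFinset (h : IsStarCenter G o v) (hfree : fishGraph.Free G)
    (hr : 4 ≤ codegree G o v) {w : V} (hw : w ∈ farFinset G o) : codegree G o w ≤ 2 := by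
  by_contra! hc
  rw [mem_farFinset] at hw
  obtain ⟨a, ha, b, hb, hab, hav, hbv⟩ :=
    exists_ne_notMem_of_card_add_two_le (t := {v}) (Nat.succ_le_of_lt hc)
  obtain ⟨l, hl, -, -, -, hlab, -⟩ := exists_ne_notMem_of_card_add_two_le (t := {a, b})
    (hr.trans' (Nat.add_le_add_right card_le_two 2))
  simp only [mem_inter, mem_neighborFinset] at ha hb hl
  have hov := h.adj
  exact hfree (fishGraph_isContained ha.1 ha.2.symm hb.2 hb.1.symm hov hl.2 hl.1.symm
    (by grind [SimpleGraph.ne_of_adj]))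

end IsStarCenter

namespace IsMaxEigenvector

variable {μ : ℝ} {x : V → ℝ}

theorem exists_isStarCenter (hx : IsMaxEigenvector G μ x o) (hfree : fishGraph.Free G)
    (hμ : 8 < μ) (hE : #G.edgeFinset - 2 < μ ^ 2 - μ) :
    ∃ v, IsStarCenter G o v ∧ 4 ≤ codegree G o v := by
  have hid := hx.sq_eigenvalue_sub_card_edgeFinset
  have hfar : 0 ≤ ∑ w ∈ farFinset G o, codegree G o w * (1 - x w) :=
    sum_nonneg fun w _ => hx.mul_one_sub_nonneg _ w
  have : (0 : ℝ) ≤ inducedEdgeCount G (farFinset G o) := Nat.cast_nonneg _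
  have hle : ∑ w ∈ G.neighborFinset o, codegree G o w * x w ≤
      2 * inducedEdgeCount G (G.neighborFinset o) := by
    rw [← Nat.cast_ofNat, ← Nat.cast_mul, ← sum_codegree_neighborFinset, Nat.cast_sum]
    exact sum_le_sum fun w _ => mul_le_of_le_one_right (Nat.cast_nonneg _) (hx.le_one w)
  have hsix : (6 : ℝ) < inducedEdgeCount G (G.neighborFinset o) := by linarith
  obtain ⟨u, hou, hu⟩ : ∃ u ∈ G.neighborFinset o, 2 ≤ codegree G o u := by
    by_contra! hlt
    have : ∑ w ∈ G.neighborFinset o, codegree G o w * x w ≤ μ := by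
      rw [hx.eigenvalue_eq_sum]
      refine sum_le_sum fun w hw => mul_le_of_le_one_left (hx.nonneg w) ?_
      exact_mod_cast Nat.le_of_lt_succ (hlt w hw)
    linarith
  exact _root_.exists_isStarCenter hfree (by exact_mod_cast hsix) (by simpa using hou) hu

theorem deficiency_identity (hx : IsMaxEigenvector G μ x o) (h : IsStarCenter G o v) :
    μ ^ 2 - μ - (#G.edgeFinset - 2) = 1 - (codegree G o v - 1) * (1 - x v) -
      ∑ y ∈ privateNeighborFinset G o v, x y -
      ∑ w ∈ farFinset G o, codegree G o w * (1 - x w) - inducedEdgeCount G (farFinset G o) := by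
  have hid := hx.sq_eigenvalue_sub_card_edgeFinset
  have hsum := hx.eigenvalue_eq_sum
  rw [h.sum_codegree_mul, h.inducedEdgeCount_eq] at hid
  rw [sum_neighborFinset_eq h.adj] at hsum
  linear_combination hid - hsum

end IsMaxEigenvector

end Star

section Far

variable {V : Type*} [Fintype V] [DecidableEq V] {G : SimpleGraph V} [DecidableRel G.Adj]
  {o v w : V}

theorem degree_eq_codegree (hfar : inducedEdgeCount G (farFinset G o) = 0)
    (hw : w ∈ farFinset G o) : G.degree w = codegree G o w := by
  have hsum := sum_card_inter_neighborFinset G (farFinset G o)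
  rw [hfar, mul_zero, sum_eq_zero_iff] at hsum
  rw [degree_eq_codegree_add hw, hsum w hw, add_zero]

namespace IsMaxEigenvector

variable {μ : ℝ} {x : V → ℝ}

theorem deficiency_lt_one (hx : IsMaxEigenvector G μ x o) (h : IsStarCenter G o v)
    (hr : 1 ≤ codegree G o v) (hE : #G.edgeFinset - 2 < μ ^ 2 - μ) :
    ∑ y ∈ privateNeighborFinset G o v, x y + ∑ w ∈ farFinset G o, codegree G o w * (1 - x w) +
      inducedEdgeCount G (farFinset G o) < 1 := by
  have hid := hx.deficiency_identity h
  have hv := hx.mul_one_sub_nonneg (codegree G o v - 1) v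
  push_cast [hr] at hv
  linarith

theorem inducedEdgeCount_farFinset (hx : IsMaxEigenvector G μ x o) (h : IsStarCenter G o v)
    (hr : 1 ≤ codegree G o v) (hE : #G.edgeFinset - 2 < μ ^ 2 - μ) :
    inducedEdgeCount G (farFinset G o) = 0 := by
  have hlt := hx.deficiency_lt_one h hr hE
  have hprivate := sum_nonneg fun y (_ : y ∈ privateNeighborFinset G o v) => hx.nonneg y
  have hfar : 0 ≤ ∑ w ∈ farFinset G o, codegree G o w * (1 - x w) :=
    sum_nonneg fun w _ => hx.mul_one_sub_nonneg _ w
  rw [← Nat.lt_one_iff]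
  exact_mod_cast (by linarith : (inducedEdgeCount G (farFinset G o) : ℝ) < 1)

theorem sum_codegree_farFinset_le_one (hx : IsMaxEigenvector G μ x o) (hμ : 8 ≤ μ)
    (hsum : ∑ w ∈ farFinset G o, codegree G o w * (1 - x w) < 1)
    (hdeg : ∀ w ∈ farFinset G o, G.degree w ≤ 2) :
    ∑ w ∈ farFinset G o, codegree G o w ≤ 1 := by
  have hle : ∀ w ∈ farFinset G o, x w ≤ 1 / 4 := fun w hw => by
    have hμx : μ * x w ≤ 2 := (hx.mul_apply_le_degree w).trans (mod_cast hdeg w hw)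
    linarith [mul_le_mul_of_nonneg_right hμ (hx.nonneg w)]
  have hmul : (∑ w ∈ farFinset G o, codegree G o w : ℕ) * (3 / 4 : ℝ) < 1 := by
    refine hsum.trans_le' ?_
    rw [Nat.cast_sum, sum_mul]
    gcongr with w hw
    linarith [hle w hw]
  rw [← Nat.lt_succ_iff]
  exact_mod_cast (by linarith : ((∑ w ∈ farFinset G o, codegree G o w : ℕ) : ℝ) < 2)

theorem privateNeighborFinset_eq_empty (hx : IsMaxEigenvector G μ x o) (hμ : 0 < μ)
    (hdef : ∑ y ∈ privateNeighborFinset G o v, x y +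
      ∑ w ∈ farFinset G o, codegree G o w * (1 - x w) < 1)
    (hw : w ∈ farFinset G o) (hcodeg : codegree G o w = 1) (hdeg : G.degree w = 1) :
    privateNeighborFinset G o v = ∅ := by
  rw [eq_empty_iff_forall_notMem]
  intro y hy
  have hwy : x w ≤ x y := by
    refine le_of_mul_le_mul_left ?_ hμ
    calc μ * x w ≤ G.degree w := hx.mul_apply_le_degree w
      _ = 1 := by rw [hdeg, Nat.cast_one]
      _ ≤ μ * x y := hx.one_le_mul_apply (mem_privateNeighborFinset.1 hy).1
  have hy_le := single_le_sum (fun z _ => hx.nonneg z) hy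
  have hw_le := single_le_sum (fun z _ => hx.mul_one_sub_nonneg (codegree G o z) z) hw
  rw [hcodeg, Nat.cast_one, one_mul] at hw_le
  linarith

theorem farFinset_eq_empty (hx : IsMaxEigenvector G μ x o) (h : IsStarCenter G o v)
    (hfree : fishGraph.Free G) (hr : 4 ≤ codegree G o v) (hiso : ∀ w, ¬ G.IsIsolated w)
    (hodd : Odd #G.edgeFinset) (hμ : 8 < μ) (hE : #G.edgeFinset - 2 < μ ^ 2 - μ) :
    farFinset G o = ∅ := by
  have hr1 : 1 ≤ codegree G o v := hr.trans' (by lia)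
  have hfarEdges := hx.inducedEdgeCount_farFinset h hr1 hE
  have hdeg : ∀ w ∈ farFinset G o, G.degree w = codegree G o w :=
    fun w hw => degree_eq_codegree hfarEdges hw
  have hdef := hx.deficiency_lt_one h hr1 hE
  rw [hfarEdges, Nat.cast_zero, add_zero] at hdef
  have hprivate := sum_nonneg fun y (_ : y ∈ privateNeighborFinset G o v) => hx.nonneg y
  have hsum := hx.sum_codegree_farFinset_le_one hμ.le (by linarith) fun w hw =>
    (hdeg w hw).trans_le (h.codegree_le_two_of_mem_farFinset hfree hr hw)
  rw [eq_empty_iff_forall_notMem]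
  intro w hw
  have hpos : 1 ≤ codegree G o w := by
    rw [← hdeg w hw, ← card_neighborFinset_eq_degree, one_le_card, neighborFinset_nonempty]
    exact hiso w
  have hle : codegree G o w ≤ ∑ w ∈ farFinset G o, codegree G o w :=
    single_le_sum (fun _ _ => Nat.zero_le _) hw
  have hcodeg : codegree G o w = 1 := by lia
  have hempty := hx.privateNeighborFinset_eq_empty (by linarith) hdef hw hcodeg
    ((hdeg w hw).trans hcodeg)
  have hcard := card_edgeFinset_eq G o
  rw [h.degree_eq, h.inducedEdgeCount_eq, hfarEdges, hempty, card_empty] at hcard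
  grind

end IsMaxEigenvector

end Far

section Dominating

variable {V : Type*} [Fintype V] [DecidableEq V] {G : SimpleGraph V} [DecidableRel G.Adj] {o v : V}

theorem adj_of_farFinset_eq_empty (hfar : farFinset G o = ∅) {y : V} (hy : y ≠ o) : G.Adj o y := by
  by_contra hoy
  exact notMem_empty y (hfar ▸ mem_farFinset.2 ⟨hy, hoy⟩)

theorem IsStarCenter.neighborFinset_eq_singleton (h : IsStarCenter G o v)
    (hfar : farFinset G o = ∅) {y : V} (hy : y ∈ privateNeighborFinset G o v) :
    G.neighborFinset y = {o} := by
  obtain ⟨hoy, hyv, hvy⟩ := mem_privateNeighborFinset.1 hy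
  refine eq_singleton_iff_unique_mem.2 ⟨by simpa using hoy.symm, fun z hz => ?_⟩
  rw [mem_neighborFinset] at hz
  by_contra hzo
  obtain rfl := (h.eq_or_eq hoy (adj_of_farFinset_eq_empty hfar hzo) hz).resolve_left hyv
  exact hvy hz.symm

theorem neighborFinset_eq_insert (hov : G.Adj o v) (hfar : farFinset G o = ∅) :
    G.neighborFinset v = insert o (G.neighborFinset o ∩ G.neighborFinset v) := by
  ext z
  have := @adj_of_farFinset_eq_empty _ _ _ _ _ _ hfar z
  grind [mem_neighborFinset, adj_comm]

theorem inducedEdgeCount_farFinset_of_eq_empty (hfar : farFinset G o = ∅) :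
    inducedEdgeCount G (farFinset G o) = 0 := by
  simpa [hfar] using sum_card_inter_neighborFinset G (farFinset G o)

theorem IsStarCenter.card_edgeFinset_eq (h : IsStarCenter G o v) (hfar : farFinset G o = ∅) :
    #G.edgeFinset = 2 * codegree G o v + 1 + #(privateNeighborFinset G o v) := by
  rw [_root_.card_edgeFinset_eq G o, h.degree_eq, h.inducedEdgeCount_eq,
    inducedEdgeCount_farFinset_of_eq_empty hfar, hfar, sum_empty]
  lia

namespace IsMaxEigenvector

variable {μ : ℝ} {x : V → ℝ}

theorem mul_sum_privateNeighborFinset (hx : IsMaxEigenvector G μ x o) (h : IsStarCenter G o v)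
    (hfar : farFinset G o = ∅) :
    μ * ∑ y ∈ privateNeighborFinset G o v, x y = #(privateNeighborFinset G o v) := by
  rw [mul_sum, card_eq_sum_ones, Nat.cast_sum, Nat.cast_one]
  refine sum_congr rfl fun y hy => ?_
  rw [hx.mul_apply, h.neighborFinset_eq_singleton hfar hy, sum_singleton, hx.apply_eq_one]

theorem add_one_mul_one_sub_center (hx : IsMaxEigenvector G μ x o) (hov : G.Adj o v)
    (hfar : farFinset G o = ∅) :
    (μ + 1) * (1 - x v) = ∑ y ∈ privateNeighborFinset G o v, x y := by
  have hv := hx.mul_apply v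
  rw [neighborFinset_eq_insert hov hfar, sum_insert (by simp), hx.apply_eq_one] at hv
  have ho := hx.eigenvalue_eq_sum
  rw [sum_neighborFinset_eq hov] at ho
  linear_combination ho - hv

theorem excess_mul_eq (hx : IsMaxEigenvector G μ x o) (h : IsStarCenter G o v)
    (hfar : farFinset G o = ∅) :
    (μ ^ 2 - μ - (#G.edgeFinset - 2)) * (μ * (μ + 1)) =
      μ * (μ + 1) - #(privateNeighborFinset G o v) * (codegree G o v + μ) := by
  have hid := hx.deficiency_identity h
  rw [inducedEdgeCount_farFinset_of_eq_empty hfar, hfar, sum_empty, Nat.cast_zero, sub_zero,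
    sub_zero] at hid
  have hprivate := hx.mul_sum_privateNeighborFinset h hfar
  have hcenter := hx.add_one_mul_one_sub_center h.adj hfar
  linear_combination μ * (μ + 1) * hid - (codegree G o v - 1) * μ * hcenter -
    (codegree G o v + μ) * hprivate

theorem card_privateNeighborFinset_lt_four (hx : IsMaxEigenvector G μ x o)
    (h : IsStarCenter G o v) (hfar : farFinset G o = ∅) (hr : 1 ≤ codegree G o v) (hμ : 1 ≤ μ)
    (hE : #G.edgeFinset - 2 < μ ^ 2 - μ) : #(privateNeighborFinset G o v) < 4 := by
  have hexcess := hx.excess_mul_eq h hfar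
  have hE' : μ ^ 2 - μ - (#G.edgeFinset - 2) ≤ 1 := by
    have hv := hx.mul_one_sub_nonneg (codegree G o v - 1) v
    have hprivate := sum_nonneg fun y (_ : y ∈ privateNeighborFinset G o v) => hx.nonneg y
    rw [hx.deficiency_identity h, inducedEdgeCount_farFinset_of_eq_empty hfar, hfar, sum_empty]
    push_cast [hr] at hv ⊢
    linarith
  have hpos : 0 < (μ ^ 2 - μ - (#G.edgeFinset - 2)) * (μ * (μ + 1)) := by
    have := sub_pos.2 hE
    positivity
  have hr' : (1 : ℝ) ≤ codegree G o v := mod_cast hr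
  rw [hexcess] at hpos
  rw [h.card_edgeFinset_eq hfar] at hE'
  push_cast at hE'
  have hlt : (#(privateNeighborFinset G o v) - 2 : ℝ) * (codegree G o v + μ) <
      #(privateNeighborFinset G o v) := by linarith
  by_contra! hs
  have hs' : (4 : ℝ) ≤ #(privateNeighborFinset G o v) := mod_cast hs
  have hmul := mul_le_mul_of_nonneg_left (by linarith : (2 : ℝ) ≤ codegree G o v + μ)
    (by linarith : (0 : ℝ) ≤ #(privateNeighborFinset G o v) - 2)
  linarith [hmul.trans_lt hlt]

theorem excess_mul_eq_one (hx : IsMaxEigenvector G μ x o) (h : IsStarCenter G o v)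
    (hfar : farFinset G o = ∅) (hs : #(privateNeighborFinset G o v) = 2) :
    (μ ^ 2 - μ - (#G.edgeFinset - 2)) * (μ ^ 2 + μ - 1) = 1 := by
  have hexcess := hx.excess_mul_eq h hfar
  rw [h.card_edgeFinset_eq hfar, hs] at hexcess ⊢
  push_cast at hexcess ⊢
  linear_combination hexcess

end IsMaxEigenvector

end Dominating

section Isomorphism

/-- The graph `K_1 ∨ (K_{1,r} ∪ s K_1)`, which is the extremal graph for `s = 2` and the book graph
for `s = 0`. -/
abbrev starJoin (r s : ℕ) : SimpleGraph (Fin 1 ⊕ ((Fin 1 ⊕ Fin r) ⊕ Fin s)) :=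
  graphJoin (completeG 1) (SimpleGraph.sum (starG r) (emptyG s))

theorem nonempty_starJoin_zero_iso_bookGraph (k : ℕ) : Nonempty (starJoin k 0 ≃g bookGraph k) := by
  refine ⟨⟨⟨Sum.elim (fun _ => .inl 0) (Sum.elim (Sum.elim (fun _ => .inl 1) .inr) finZeroElim),
    Sum.elim ![.inl 0, .inr (.inl (.inl 0))] fun i => .inr (.inl (.inr i)), ?_, ?_⟩, ?_⟩⟩
  · rintro (a | (a | a) | a)
    · simp [Subsingleton.elim a 0]
    · simp [Subsingleton.elim a 0]
    · rfl
    · exact a.elim0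
  · rintro (a | a)
    · fin_cases a <;> rfl
    · rfl
  · rintro (a | (a | a) | a) (b | (b | b) | b) <;> first | exact a.elim0 | exact b.elim0 | skip
    all_goals simp [bookGraph, graphJoin, completeG, starG, emptyG, eq_iff_true_of_subsingleton]

variable {V : Type*} [Fintype V] [DecidableEq V] {G : SimpleGraph V} [DecidableRel G.Adj] {o v : V}

namespace IsStarCenter

theorem adj_iff (h : IsStarCenter G o v) (hfar : farFinset G o = ∅) (y z : V) :
    G.Adj y z ↔ y = o ∧ z ≠ o ∨ z = o ∧ y ≠ o ∨ y = v ∧ G.Adj v z ∨ z = v ∧ G.Adj v y := by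
  have := @adj_of_farFinset_eq_empty _ _ _ _ _ _ hfar
  have := @h.eq_or_eq y z
  grind [adj_comm, G.irrefl]

theorem nonempty_iso_starJoin (h : IsStarCenter G o v) (hfar : farFinset G o = ∅) :
    Nonempty (G ≃g starJoin (codegree G o v) #(privateNeighborFinset G o v)) := by
  let e : Fin (codegree G o v) ≃ ↥(G.neighborFinset o ∩ G.neighborFinset v) := (equivFin _).symm
  let p : Fin #(privateNeighborFinset G o v) ≃ privateNeighborFinset G o v := (equivFin _).symm
  have he i : G.Adj o (e i) ∧ G.Adj v (e i) := by
    simpa only [mem_inter, mem_neighborFinset] using (e i).2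
  have hp i : G.Adj o (p i) ∧ (p i : V) ≠ v ∧ ¬ G.Adj v (p i) := mem_privateNeighborFinset.1 (p i).2
  let f := Sum.elim (fun _ : Fin 1 => o)
    (Sum.elim (Sum.elim (fun _ : Fin 1 => v) fun i => (e i : V)) fun i => (p i : V))
  have hinj : f.Injective := by
    refine (Function.injective_of_subsingleton _).sumElim
      (((Function.injective_of_subsingleton _).sumElim
          (Subtype.val_injective.comp e.injective) fun _ i => (he i).2.ne).sumElim
        (Subtype.val_injective.comp p.injective) ?_) ?_
    · rintro (_ | i) j
      exacts [(hp j).2.1.symm, fun hij => (hp j).2.2 (hij ▸ (he i).2)]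
    · rintro _ ((_ | i) | j)
      exacts [h.adj.ne, (he i).1.ne, (hp j).1.ne]
  have hsurj : f.Surjective := by
    intro y
    by_cases hyo : y = o
    · exact ⟨.inl 0, hyo.symm⟩
    by_cases hyv : y = v
    · exact ⟨.inr (.inl (.inl 0)), hyv.symm⟩
    have hoy := adj_of_farFinset_eq_empty hfar hyo
    by_cases hvy : G.Adj v y
    · exact ⟨.inr (.inl (.inr (e.symm ⟨y, by simp [hoy, hvy]⟩))), by simp [f]⟩
    · exact ⟨.inr (.inr (p.symm ⟨y, mem_privateNeighborFinset.2 ⟨hoy, hyv, hvy⟩⟩)), by simp [f]⟩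
  refine ⟨RelIso.symm ⟨.ofBijective f ⟨hinj, hsurj⟩, ?_⟩⟩
  intro a b
  change G.Adj (f a) (f b) ↔ _
  rw [h.adj_iff hfar]
  rcases a with a | (a | a) | a <;> rcases b with b | (b | b) | b <;>
    simp [f, graphJoin, completeG, starG, emptyG, h.adj.ne, h.adj.ne', he, hp,
      fun i => (he i).1.ne', fun i => (he i).2.ne', fun i => (hp i).1.ne',
      eq_iff_true_of_subsingleton]

end IsStarCenter

end Isomorphism

section Extremal

variable {V : Type*} [Fintype V] [DecidableEq V] {G : SimpleGraph V} [DecidableRel G.Adj]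

theorem spectrum_adjMatrix_eq_of_iso {W K : Type*} [Fintype W] [DecidableEq W] [Field K]
    {H : SimpleGraph W} [DecidableRel H.Adj] (φ : G ≃g H) :
    spectrum K (G.adjMatrix K) = spectrum K (H.adjMatrix K) := by
  rw [← φ.reindex_adjMatrix K, ← Matrix.coe_reindexAlgEquiv K, AlgEquiv.spectrum_eq]

theorem mem_spectrum_adjMatrix_starJoin {r s : ℕ} [DecidableRel (starJoin r s).Adj] {x : ℝ}
    (hx : x ≠ 0) (hr : x ^ 2 ≠ r) (h : (x ^ 2 - r) * (x ^ 2 - r - s) = (x + r) ^ 2) :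
    x ∈ spectrum ℝ ((starJoin r s).adjMatrix ℝ) := by
  have hr' : x ^ 2 - r ≠ 0 := sub_ne_zero.2 hr
  obtain ⟨y, hy⟩ : ∃ y, y * (x ^ 2 - r) = x + r := ⟨_, div_mul_cancel₀ _ hr'⟩
  have hy' : (x + r) * y = x ^ 2 - r - s :=
    mul_left_cancel₀ hr' (by linear_combination (x + r) * hy - h)
  refine mem_spectrum_iff_exists_mulVec_eq_smul.2 ⟨Sum.elim (fun _ => 1)
    (Sum.elim (Sum.elim (fun _ => y) fun _ => (1 + y) / x) fun _ => 1 / x),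
    fun h0 => by simpa using congrFun h0 (.inl 0), ?_⟩
  ext (i | (i | i) | i) <;>
    simp [Matrix.mulVec, dotProduct, adjMatrix_apply, graphJoin, completeG, starG, emptyG,
      eq_iff_true_of_subsingleton] <;>
    field_simp
  · linear_combination hy'
  · linear_combination -hy

theorem le_graphSpectralRadius_of_iso_extremalGraph {k : ℕ} (φ : G ≃g extremalGraph k) {x : ℝ}
    (hx : 1 ≤ x) (hroot : (x ^ 2 - x - (2 * k + 1)) * (x ^ 2 + x - 1) = 1) :
    x ≤ graphSpectralRadius G := by
  classical
  have : Nonempty V := ⟨φ.symm (.inl 0)⟩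
  have hsq := sub_two_lt_sq_sub_self (m := 2 * k + 3) hx (by linear_combination hroot)
  have hspec : x ∈ spectrum ℝ (G.adjMatrix ℝ) := by
    rw [spectrum_adjMatrix_eq_of_iso φ]
    refine mem_spectrum_adjMatrix_starJoin (by positivity) (fun h => ?_) ?_
    · linarith [k.cast_nonneg (α := ℝ)]
    · push_cast
      linear_combination hroot
  exact (le_abs_self x).trans ((isGreatest_graphSpectralRadius G).2 ⟨x, hspec, rfl⟩)

omit [DecidableEq V] in
theorem IsMaxEigenvector.iso_bookGraph_or_iso_extremalGraph {μ : ℝ} {x : V → ℝ} {o : V}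
    (hx : IsMaxEigenvector G μ x o) (hfree : fishGraph.Free G) (hodd : Odd #G.edgeFinset)
    (hiso : ∀ v, ¬ G.IsIsolated v) (hμ : 8 < μ) (hE : #G.edgeFinset - 2 < μ ^ 2 - μ) :
    Nonempty (G ≃g bookGraph ((#G.edgeFinset - 1) / 2)) ∨
      Nonempty (G ≃g extremalGraph ((#G.edgeFinset - 3) / 2)) ∧
        (μ ^ 2 - μ - (#G.edgeFinset - 2)) * (μ ^ 2 + μ - 1) = 1 := by
  classical
  obtain ⟨v, hv, hr⟩ := hx.exists_isStarCenter hfree hμ hE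
  have hfar := hx.farFinset_eq_empty hv hfree hr hiso hodd hμ hE
  obtain ⟨φ⟩ := hv.nonempty_iso_starJoin hfar
  have hlt := hx.card_privateNeighborFinset_lt_four hv hfar (by lia) (by linarith) hE
  have hcard := hv.card_edgeFinset_eq hfar
  obtain ⟨j, hj⟩ := hodd
  obtain hs | hs : #(privateNeighborFinset G o v) = 0 ∨ #(privateNeighborFinset G o v) = 2 := by
    lia
  · obtain ⟨ψ⟩ := nonempty_starJoin_zero_iso_bookGraph (codegree G o v)
    rw [hs] at φ
    rw [show (#G.edgeFinset - 1) / 2 = codegree G o v by lia]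
    exact .inl ⟨φ.trans ψ⟩
  · refine .inr ⟨?_, hx.excess_mul_eq_one hv hfar hs⟩
    rw [hs] at φ
    rw [show (#G.edgeFinset - 3) / 2 = codegree G o v by lia]
    exact ⟨φ⟩

end Extremal

theorem theorem1p1 {V : Type*} [Fintype V] [DecidableEq V] (G : SimpleGraph V)
    [DecidableRel G.Adj] (m : ℕ) (hm : 58 ≤ m) (hodd : Odd m)
    (hfree : fishGraph.Free G)
    (hedges : G.edgeFinset.card = m)
    (hiso : ∀ v : V, ¬ G.IsIsolated v)
    (hbook : ¬ Nonempty (G ≃g bookGraph ((m - 1) / 2))) :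
    ∃ L : ℝ,
      IsGreatest {x : ℝ | x ^ 4 - (m : ℝ) * x ^ 2 - ((m : ℝ) - 3) * x + (m : ℝ) - 3 = 0} L ∧
      graphSpectralRadius G ≤ L ∧
      (graphSpectralRadius G = L ↔ Nonempty (G ≃g extremalGraph ((m - 3) / 2))) := by
  obtain ⟨L, hL, hL1⟩ := exists_isGreatest_quartic_root (m := (m : ℝ)) (by norm_cast; lia)
  have hroot := quartic_eq_zero_iff.1 hL.1
  have hm' : (58 : ℝ) ≤ m := mod_cast hm
  have hmL := sub_two_lt_sq_sub_self hL1 hroot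
  have hlarge (hle : L ≤ graphSpectralRadius G) :
      graphSpectralRadius G ≤ L ∧ Nonempty (G ≃g extremalGraph ((m - 3) / 2)) := by
    subst hedges
    have : Nonempty V := ⟨(card_pos.1 hodd.pos).choose.out.1⟩
    obtain ⟨x, o, hx⟩ := exists_isMaxEigenvector G
    obtain hG | ⟨hG, hμ⟩ := hx.iso_bookGraph_or_iso_extremalGraph hfree hodd hiso
      (by nlinarith) (by nlinarith)
    · exact absurd hG hbook
    · exact ⟨hL.2 (quartic_eq_zero_iff.2 hμ), hG⟩
  have hle : graphSpectralRadius G ≤ L :=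
    (le_total L (graphSpectralRadius G)).elim (fun h => (hlarge h).1) id
  refine ⟨L, hL, hle, fun h => (hlarge h.ge).2, fun ⟨φ⟩ => hle.antisymm ?_⟩
  have hk : m = 2 * ((m - 3) / 2) + 3 := by obtain ⟨j, rfl⟩ := hodd; lia
  have hk' : (m : ℝ) = 2 * ((m - 3) / 2 : ℕ) + 3 := mod_cast hk
  exact le_graphSpectralRadius_of_iso_extremalGraph φ hL1
    (by linear_combination hroot + (L ^ 2 + L - 1) * hk')
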